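/- For every $d\in\mathbb N$ there is a constant $C>0$, depending only on $d$, such that for all integers $n\ge 1$ and $k\ge 0$ there is a randomized query algorithm that receives an input $x^\star\in\{0,1\}^n$ and has query access to an unknown function $f:\{0,1\}^n\to\{0,1\}$, with the following guarantee. For every monotone $f$ with certificate complexity at most $k$ and every $x^\star$, the algorithm always makes at most $C\,k^8\log n$ queries to $f$, and with probability at least $1-n^{-d}$ over its internal randomness it outputs a set $S\subseteq\{1,\dots,n\}$ with $|S|\le k$ that is a certificate for the value of $f$ at $x^\star$. Here $S$ is a certificate for the value of $f$ at $x$ if $f(y)=f(x)$ for all $y\in\{0,1\}^n$ that agree with $x$ on the coordinates in $S$; the certificate complexity of $f$ is the maximum over $x\in\{0,1\}^n$ of the minimum size of a certificate for the value of $f$ at $x$. A randomized query algorithm is a probability distribution over deterministic adaptive query algorithms (decision trees). -/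

import Mathlib

/-- `S` certifies the value of `f` at `x`: `f` takes the value `f x` on every input that agrees
with `x` on the coordinates in `S`. -/
def IsCertificate {n : ℕ} (f : (Fin n → Bool) → Bool) (x : Fin n → Bool)
    (S : Finset (Fin n)) : Prop :=
  ∀ y : Fin n → Bool, (∀ i ∈ S, y i = x i) → f y = f x

/-- `C(f, x)`: the minimum size of a certificate for the value of `f` at `x`. -/
noncomputable def certComplexityAt {n : ℕ} (f : (Fin n → Bool) → Bool) (x : Fin n → Bool) : ℕ :=
  sInf {m : ℕ | ∃ S : Finset (Fin n), S.card = m ∧ IsCertificate f x S}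

/-- The minimum in `certComplexityAt` is over a nonempty set, since all coordinates together
form a certificate. -/
theorem certComplexityAt_set_nonempty {n : ℕ} (f : (Fin n → Bool) → Bool) (x : Fin n → Bool) :
    {m : ℕ | ∃ S : Finset (Fin n), S.card = m ∧ IsCertificate f x S}.Nonempty :=
  ⟨_, Finset.univ, rfl, fun _ hy => congrArg f (funext fun i => hy i (Finset.mem_univ i))⟩

/-- `C(f)`: the certificate complexity of `f`, the maximum of `C(f, x)` over all inputs `x`. -/
noncomputable def certComplexity {n : ℕ} (f : (Fin n → Bool) → Bool) : ℕ :=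
  Finset.univ.sup (certComplexityAt f)

/-- A deterministic adaptive query algorithm (decision tree) with query access to a function on
`{0,1}^n` and outputs in `α`: it either stops with an output, or queries the function at a point
and continues depending on the answer. -/
inductive QueryAlg (n : ℕ) (α : Type) : Type where
  | output (a : α) : QueryAlg n α
  | query (x : Fin n → Bool) (next : Bool → QueryAlg n α) : QueryAlg n α

/-- The output of the algorithm when its queries are answered by `f`. -/
def QueryAlg.run {n : ℕ} {α : Type} (f : (Fin n → Bool) → Bool) : QueryAlg n α → α
  | .output a => a
  | .query x next => (next (f x)).run f

/-- The number of queries the algorithm makes when they are answered by `f`. -/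
def QueryAlg.numQueries {n : ℕ} {α : Type} (f : (Fin n → Bool) → Bool) : QueryAlg n α → ℕ
  | .output _ => 0
  | .query x next => (next (f x)).numQueries f + 1

/-- A randomized query algorithm: a probability distribution over deterministic ones. -/
abbrev RandQueryAlg (n : ℕ) (α : Type) : Type := PMF (QueryAlg n α)

/-- The probability, over the algorithm's internal randomness, that its output on `f`
satisfies `P`. -/
noncomputable def RandQueryAlg.prob {n : ℕ} {α : Type} (A : RandQueryAlg n α)
    (f : (Fin n → Bool) → Bool) (P : α → Prop) : ℝ :=
  (PMF.toOuterMeasure A {T | P (T.run f)}).toReal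

/-- Every run of the algorithm on `f` (whatever its random choices) makes at most `q` queries. -/
def RandQueryAlg.QueriesAtMost {n : ℕ} {α : Type} (A : RandQueryAlg n α)
    (f : (Fin n → Bool) → Bool) (q : ℝ) : Prop :=
  ∀ T ∈ PMF.support A, ((QueryAlg.numQueries f T : ℕ) : ℝ) ≤ q

/-! A deterministic search suffices, with `O(k log n)` queries. For monotone `f` and `b = f x`, a
set `S` is a certificate iff `f` is `b` at the input equal to `x` on `S` and `!b` elsewhere, so one
query tests it. Keep a set `T` that certifies together with the first `m` coordinates, each element
of `T` being essential: its removal destroys the certificate. If `T` alone fails, bisection on the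
prefix length gives a new essential coordinate, which joins `T` and becomes the new `m`. Essential
coordinates are sensitive at one common input, so there are at most `k`
(`card_le_certComplexity_of_essential`), and `T` certifies after at most `k` rounds. -/

namespace QueryAlg

variable {n : ℕ} {α β : Type}

/-- Run an algorithm and continue with its output. -/
def bind (g : α → QueryAlg n β) : QueryAlg n α → QueryAlg n β
  | .output a => g a
  | .query x next => .query x fun c => (next c).bind g

theorem run_bind (f : (Fin n → Bool) → Bool) (g : α → QueryAlg n β) (T : QueryAlg n α) :
    (T.bind g).run f = (g (T.run f)).run f := by
  induction T with
  | output a => rfl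
  | query x next ih => exact ih (f x)

theorem numQueries_bind (f : (Fin n → Bool) → Bool) (g : α → QueryAlg n β) (T : QueryAlg n α) :
    (T.bind g).numQueries f = T.numQueries f + (g (T.run f)).numQueries f := by
  induction T with
  | output a => simp [bind, run, numQueries]
  | query x next ih =>
    simp only [bind, run, numQueries, ih (f x)]
    omega

/-- Binary search between `lo` and `hi` for an index at which the answers along the sequence `q`
change to `b`. -/
def bisect (b : Bool) (q : ℕ → Fin n → Bool) : ℕ → ℕ → ℕ → QueryAlg n ℕ
  | 0, lo, _ => .output lo
  | s + 1, lo, hi => .query (q ((lo + hi) / 2)) fun c =>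
      if c = b then bisect b q s lo ((lo + hi) / 2) else bisect b q s ((lo + hi) / 2) hi

theorem numQueries_bisect (f : (Fin n → Bool) → Bool) (b : Bool) (q : ℕ → Fin n → Bool)
    (s lo hi : ℕ) : (bisect b q s lo hi).numQueries f = s := by
  induction s generalizing lo hi with
  | zero => rfl
  | succ s ih =>
    simp only [bisect, numQueries]
    split_ifs <;> rw [ih]

/-- Only the endpoint values matter, so monotonicity along `q` is not needed. -/
theorem run_bisect (f : (Fin n → Bool) → Bool) (b : Bool) (q : ℕ → Fin n → Bool)
    (s lo hi : ℕ) (hlt : lo < hi) (hs : hi ≤ lo + 2 ^ s)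
    (hlo : f (q lo) ≠ b) (hhi : f (q hi) = b) :
    (bisect b q s lo hi).run f < hi ∧ f (q ((bisect b q s lo hi).run f)) ≠ b ∧
      f (q ((bisect b q s lo hi).run f + 1)) = b := by
  induction s generalizing lo hi with
  | zero =>
    obtain rfl : hi = lo + 1 := by simp at hs; omega
    exact ⟨hlt, hlo, hhi⟩
  | succ s ih =>
    rw [pow_succ] at hs
    simp only [bisect, run]
    split_ifs with h
    · have hne : lo ≠ (lo + hi) / 2 := fun e => hlo (by rw [e]; exact h)
      obtain ⟨h1, h2⟩ := ih lo ((lo + hi) / 2) (by omega) (by omega) hlo h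
      exact ⟨by omega, h2⟩
    · exact ih ((lo + hi) / 2) hi (by omega) (by omega) h hhi

end QueryAlg

section Certificates

variable {n : ℕ}

/-- The input that agrees with `x` on `S` and takes the value `!b` elsewhere. -/
def fillAgainst (b : Bool) (x : Fin n → Bool) (S : Finset (Fin n)) : Fin n → Bool :=
  fun i => if i ∈ S then x i else !b

/-- Among the inputs agreeing with `x` on `S`, the filled one is extremal in the direction away from
`b`. -/
theorem eq_of_agree_of_fillAgainst {f : (Fin n → Bool) → Bool} (hf : Monotone f) {b : Bool}
    {x y : Fin n → Bool} {S : Finset (Fin n)} (hS : f (fillAgainst b x S) = b)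
    (hy : ∀ i ∈ S, y i = x i) : f y = b := by
  cases b with
  | true =>
    have hle : fillAgainst true x S ≤ y := fun i => by
      by_cases hi : i ∈ S <;> simp [fillAgainst, hi, hy]
    have h := hf hle
    rw [hS] at h
    exact top_le_iff.mp h
  | false =>
    have hle : y ≤ fillAgainst false x S := fun i => by
      by_cases hi : i ∈ S
      · simp [fillAgainst, hi, hy]
      · simp [fillAgainst, hi, Bool.le_true]
    have h := hf hle
    rw [hS] at h
    exact le_bot_iff.mp h

theorem fillAgainst_mono {f : (Fin n → Bool) → Bool} (hf : Monotone f) {b : Bool}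
    {x : Fin n → Bool} {S T : Finset (Fin n)} (hST : S ⊆ T) (hS : f (fillAgainst b x S) = b) :
    f (fillAgainst b x T) = b :=
  eq_of_agree_of_fillAgainst hf hS fun i hi => by simp [fillAgainst, hST hi]

theorem isCertificate_of_fillAgainst {f : (Fin n → Bool) → Bool} (hf : Monotone f)
    {x : Fin n → Bool} {S : Finset (Fin n)} (hS : f (fillAgainst (f x) x S) = f x) :
    IsCertificate f x S :=
  fun _ hy => eq_of_agree_of_fillAgainst hf hS hy

theorem exists_isCertificate_card_le (f : (Fin n → Bool) → Bool) (x : Fin n → Bool) :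
    ∃ S : Finset (Fin n), S.card ≤ certComplexity f ∧ IsCertificate f x S := by
  obtain ⟨S, hcard, hS⟩ := Nat.sInf_mem (certComplexityAt_set_nonempty f x)
  exact ⟨S, hcard.trans_le (Finset.le_sup (f := certComplexityAt f) (Finset.mem_univ x)), hS⟩

/-- Every certificate at an input contains all coordinates that are sensitive there. -/
theorem card_le_certComplexity_of_essential {f : (Fin n → Bool) → Bool} {b : Bool}
    {x : Fin n → Bool} {T V : Finset (Fin n)} (hV : f (fillAgainst b x V) = b)
    (hT : ∀ t ∈ T, f (fillAgainst b x (V.erase t)) ≠ b) : T.card ≤ certComplexity f := by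
  obtain ⟨U, hcard, hU⟩ := exists_isCertificate_card_le f (fillAgainst b x V)
  refine (Finset.card_le_card fun t ht => ?_).trans hcard
  by_contra htU
  refine hT t ht ((hU _ fun i hi => ?_).trans hV)
  have hne : i ≠ t := fun e => htU (e ▸ hi)
  simp [fillAgainst, hne]

/-- The coordinates of `T` together with the first `j` coordinates. -/
def withPrefix (T : Finset (Fin n)) (j : ℕ) : Finset (Fin n) :=
  T ∪ Finset.univ.filter fun i => i.val < j

theorem mem_withPrefix {T : Finset (Fin n)} {j : ℕ} {i : Fin n} :
    i ∈ withPrefix T j ↔ i ∈ T ∨ i.val < j := by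
  simp [withPrefix]

/-- The set of coordinates whose index is `j`: a singleton if `j < n`. -/
def coordSet (n j : ℕ) : Finset (Fin n) :=
  Finset.univ.filter fun i => i.val = j

theorem coordSet_val (i : Fin n) : coordSet n i.val = {i} := by
  ext; simp [coordSet, Fin.ext_iff]

/-- Starting from a set `T` of essential coordinates that becomes a certificate together with the
first `m` coordinates, find up to `r` further essential coordinates, each by binary search. -/
def QueryAlg.extendEssential (b : Bool) (x : Fin n → Bool) :
    ℕ → Finset (Fin n) → ℕ → QueryAlg n (Finset (Fin n))
  | 0, T, _ => .output T
  | r + 1, T, m => .query (fillAgainst b x T) fun c =>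
      if c = b then .output T
      else (QueryAlg.bisect b (fun j => fillAgainst b x (withPrefix T j)) (Nat.clog 2 n) 0 m).bind
        fun j => extendEssential b x r (T ∪ coordSet n j) j

theorem QueryAlg.numQueries_extendEssential (f : (Fin n → Bool) → Bool) (b : Bool)
    (x : Fin n → Bool) (r : ℕ) (T : Finset (Fin n)) (m : ℕ) :
    (extendEssential b x r T m).numQueries f ≤ r * (1 + Nat.clog 2 n) := by
  induction r generalizing T m with
  | zero => simp [extendEssential, numQueries]
  | succ r ih =>
    simp only [extendEssential, numQueries]
    rw [Nat.succ_mul]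
    split_ifs
    · simp only [numQueries]
      omega
    · rw [numQueries_bind, numQueries_bisect]
      have := ih (T ∪ coordSet n ((bisect b (fun j => fillAgainst b x (withPrefix T j))
        (Nat.clog 2 n) 0 m).run f))
        ((bisect b (fun j => fillAgainst b x (withPrefix T j)) (Nat.clog 2 n) 0 m).run f)
      omega

theorem withPrefix_zero (T : Finset (Fin n)) : withPrefix T 0 = T := by
  ext; simp [mem_withPrefix]

/-- One round: the coordinate at which the value changes along the prefixes is new, and it is
essential together with the previous ones. -/
theorem essential_insert {f : (Fin n → Bool) → Bool} (hf : Monotone f) {b : Bool}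
    {x : Fin n → Bool} {T : Finset (Fin n)} {m : ℕ} {i : Fin n} (him : i.val < m)
    (hlo : f (fillAgainst b x (withPrefix T i.val)) ≠ b)
    (hhi : f (fillAgainst b x (withPrefix T (i.val + 1))) = b)
    (hT : ∀ t ∈ T, f (fillAgainst b x ((withPrefix T m).erase t)) ≠ b) :
    i ∉ T ∧ f (fillAgainst b x (withPrefix (insert i T) i.val)) = b ∧
      ∀ t ∈ insert i T, f (fillAgainst b x ((withPrefix (insert i T) i.val).erase t)) ≠ b := by
  have heq : withPrefix (insert i T) i.val = withPrefix T (i.val + 1) := by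
    ext j
    simp only [mem_withPrefix, Finset.mem_insert, Fin.ext_iff]
    grind
  refine ⟨fun hi => hlo ?_, by rwa [heq], fun t ht hb => ?_⟩
  · have : withPrefix T i.val = withPrefix T (i.val + 1) := by
      rw [← heq, Finset.insert_eq_of_mem hi]
    rwa [this]
  · rcases Finset.mem_insert.mp ht with rfl | ht
    · refine hlo (fillAgainst_mono hf (fun j hj => ?_) hb)
      simp only [Finset.mem_erase, mem_withPrefix, Finset.mem_insert] at hj ⊢
      tauto
    -- The certifying set only shrinks, since `i < m`, so old essential coordinates stay essential.
    · refine hT t ht (fillAgainst_mono hf (Finset.erase_subset_erase t fun j hj => ?_) hb)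
      rw [heq] at hj
      simp only [mem_withPrefix] at hj ⊢
      grind

/-- If `T` is not yet a certificate, binary search along the prefixes finds a new essential
coordinate. -/
theorem QueryAlg.exists_essential_of_run_bisect {f : (Fin n → Bool) → Bool} (hf : Monotone f)
    {b : Bool} {x : Fin n → Bool} {T : Finset (Fin n)} {m : ℕ} (hm : m ≤ n)
    (hb : f (fillAgainst b x (withPrefix T m)) = b)
    (hT : ∀ t ∈ T, f (fillAgainst b x ((withPrefix T m).erase t)) ≠ b)
    (hne : f (fillAgainst b x T) ≠ b) :
    ∃ i : Fin n, (bisect b (fun j => fillAgainst b x (withPrefix T j))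
      (Nat.clog 2 n) 0 m).run f = i.val ∧ i ∉ T ∧
      f (fillAgainst b x (withPrefix (insert i T) i.val)) = b ∧
      ∀ t ∈ insert i T, f (fillAgainst b x ((withPrefix (insert i T) i.val).erase t)) ≠ b := by
  have hpos : 0 < m := by
    rcases Nat.eq_zero_or_pos m with rfl | h
    · rw [withPrefix_zero] at hb
      exact absurd hb hne
    · exact h
  have hpow : n ≤ 2 ^ Nat.clog 2 n := Nat.le_pow_clog one_lt_two n
  obtain ⟨h1, h2, h3⟩ := run_bisect f b (fun j => fillAgainst b x (withPrefix T j))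
    (Nat.clog 2 n) 0 m hpos (by omega) (by rwa [withPrefix_zero]) hb
  exact ⟨⟨_, h1.trans_le hm⟩, rfl, essential_insert hf (i := ⟨_, h1.trans_le hm⟩) h1 h2 h3 hT⟩

theorem QueryAlg.run_extendEssential {f : (Fin n → Bool) → Bool} (hf : Monotone f) {b : Bool}
    {x : Fin n → Bool} {k : ℕ} (hk : certComplexity f ≤ k) (r : ℕ) (T : Finset (Fin n)) (m : ℕ)
    (hm : m ≤ n) (hr : k = T.card + r) (hb : f (fillAgainst b x (withPrefix T m)) = b)
    (hT : ∀ t ∈ T, f (fillAgainst b x ((withPrefix T m).erase t)) ≠ b) :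
    ((extendEssential b x r T m).run f).card ≤ k ∧
      f (fillAgainst b x ((extendEssential b x r T m).run f)) = b := by
  induction r generalizing T m with
  | zero =>
    refine ⟨hr.ge, ?_⟩
    -- Another round would yield `k + 1` essential coordinates.
    by_contra hne
    obtain ⟨i, -, hi, hb', hT'⟩ := exists_essential_of_run_bisect hf hm hb hT hne
    have := card_le_certComplexity_of_essential hb' hT'
    rw [Finset.card_insert_of_notMem hi] at this
    omega
  | succ r ih =>
    simp only [extendEssential, run]
    split_ifs with h
    · exact ⟨by simp only [run]; omega, h⟩
    · obtain ⟨i, hrun, hi, hb', hT'⟩ := exists_essential_of_run_bisect hf hm hb hT h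
      rw [run_bind, hrun, coordSet_val, Finset.union_comm, ← Finset.insert_eq]
      refine ih _ _ i.isLt.le ?_ hb' hT'
      rw [Finset.card_insert_of_notMem hi]
      omega

/-- Query the value at `x`, then search for essential coordinates. -/
def QueryAlg.certify (k : ℕ) (x : Fin n → Bool) : QueryAlg n (Finset (Fin n)) :=
  if k = 0 then .output ∅ else .query x fun b => extendEssential b x k ∅ n

theorem QueryAlg.run_certify {f : (Fin n → Bool) → Bool} (hf : Monotone f) {k : ℕ}
    (hk : certComplexity f ≤ k) (x : Fin n → Bool) :
    ((certify k x).run f).card ≤ k ∧ IsCertificate f x ((certify k x).run f) := by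
  unfold certify
  split_ifs with h
  · obtain ⟨S, hS, hcert⟩ := exists_isCertificate_card_le f x
    obtain rfl : S = ∅ := Finset.card_eq_zero.mp (by omega)
    exact ⟨hS.trans hk, hcert⟩
  · have hb : fillAgainst (f x) x (withPrefix ∅ n) = x := by
      ext i
      simp [fillAgainst, mem_withPrefix]
    obtain ⟨h1, h2⟩ := run_extendEssential hf (b := f x) (x := x) hk k ∅ n le_rfl (by simp)
      (by rw [hb]) (by simp)
    exact ⟨h1, isCertificate_of_fillAgainst hf h2⟩

theorem QueryAlg.numQueries_certify (f : (Fin n → Bool) → Bool) (k : ℕ) (x : Fin n → Bool) :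
    (certify k x).numQueries f ≤ k * (2 + Nat.clog 2 n) := by
  unfold certify
  split_ifs with h
  · simp [numQueries]
  · have := numQueries_extendEssential f (f x) x k ∅ n
    simp only [numQueries]
    -- As `k ≥ 1`, the initial query is absorbed into the extra `k`.
    nlinarith [Nat.pos_of_ne_zero h]

end Certificates

/-- The 8 is 4 from rounding, doubled since `log 2 > 1/2`. -/
theorem two_add_clog_le_log {n : ℕ} (hn : 2 ≤ n) :
    ((2 + Nat.clog 2 n : ℕ) : ℝ) ≤ 8 * Real.log n := by
  have hclog : Nat.clog 2 n ≤ Nat.log 2 n + 1 :=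
    Nat.clog_le_of_le_pow (Nat.lt_pow_succ_log_self one_lt_two n).le
  have hpos : 1 ≤ Nat.log 2 n := Nat.log_pos one_lt_two hn
  have hle : ((2 + Nat.clog 2 n : ℕ) : ℝ) ≤ 4 * (Nat.log 2 n : ℝ) := by
    exact_mod_cast (by omega : 2 + Nat.clog 2 n ≤ 4 * Nat.log 2 n)
  have hpow : (2 : ℝ) ^ Nat.log 2 n ≤ n := by
    exact_mod_cast Nat.pow_log_le_self 2 (by omega)
  have hlog := Real.log_le_log (by positivity) hpow
  rw [Real.log_pow] at hlog
  have h2 := Real.log_two_gt_d9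
  nlinarith [(Nat.cast_nonneg (Nat.log 2 n) : (0 : ℝ) ≤ _)]

theorem theorem1 (d : ℕ) :
    ∃ C : ℝ, 0 < C ∧ ∀ n k : ℕ, 1 ≤ n →
      ∃ A : (Fin n → Bool) → RandQueryAlg n (Finset (Fin n)),
        ∀ f : (Fin n → Bool) → Bool, Monotone f → certComplexity f ≤ k →
          ∀ xstar : Fin n → Bool,
            (A xstar).QueriesAtMost f (C * (k : ℝ) ^ 8 * Real.log (n : ℝ)) ∧
            1 - 1 / (n : ℝ) ^ d ≤
              (A xstar).prob f (fun S => S.card ≤ k ∧ IsCertificate f xstar S) := by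
  refine ⟨8, by norm_num, fun n k hn => ?_⟩
  -- For `n = 1` both the query budget and the required probability are 0.
  rcases hn.eq_or_lt with rfl | hn
  · refine ⟨fun _ => PMF.pure (.output ∅), fun f _ _ x => ⟨fun T hT => ?_, ?_⟩⟩
    · obtain rfl := (PMF.mem_support_pure_iff _ _).mp hT
      simp [QueryAlg.numQueries]
    · simp [RandQueryAlg.prob]
  · refine ⟨fun x => PMF.pure (.certify k x), fun f hf hk x => ⟨fun T hT => ?_, ?_⟩⟩
    · obtain rfl := (PMF.mem_support_pure_iff _ _).mp hT
      have hq : (((QueryAlg.certify k x).numQueries f : ℕ) : ℝ) ≤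
          (k : ℝ) * ((2 + Nat.clog 2 n : ℕ) : ℝ) := by
        exact_mod_cast QueryAlg.numQueries_certify f k x
      have hk8 : (k : ℝ) ≤ (k : ℝ) ^ 8 := by
        exact_mod_cast Nat.le_self_pow (by norm_num) k
      calc _ ≤ _ := hq
        _ ≤ (k : ℝ) ^ 8 * (8 * Real.log n) :=
          mul_le_mul hk8 (two_add_clog_le_log hn) (Nat.cast_nonneg _) (by positivity)
        _ = _ := by ring
    · have hprob : RandQueryAlg.prob (PMF.pure (.certify k x)) f
          (fun S => S.card ≤ k ∧ IsCertificate f x S) = 1 := by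
        rw [RandQueryAlg.prob, PMF.toOuterMeasure_pure_apply, if_pos, ENNReal.toReal_one]
        exact QueryAlg.run_certify hf hk x
      rw [hprob]
      have : (0 : ℝ) ≤ 1 / (n : ℝ) ^ d := by positivity
      linarith
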